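/- For every integer $d\ge 1$ put $$P(d)=\prod_{k=1}^{d}\Bigl(\bigl(k-\tfrac12\bigr)^2+\tfrac34(2d-1)^2\Bigr),\qquad Q(d)=\prod_{k=1}^{d}\bigl(k^2+3d^2\bigr).$$ Then both series below converge, and $$\zeta(3)=\sum_{d=1}^{\infty}\frac{3\pi P(d)}{(2d-1)!\,(2d-1)^3\cosh\bigl(\sqrt3\,\pi(2d-1)/2\bigr)}-\sum_{d=1}^{\infty}\frac{3\sqrt3\,\pi Q(d)}{8\sinh(\sqrt3\,\pi d)\,(2d)!\,d^2},$$ where $\zeta$ is the Riemann zeta function. -/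

import Mathlib

/-- `P(d) = ∏_{k=1}^d ((k - 1/2)² + (3/4) (2d - 1)²)`, a real number. -/
noncomputable def coshProd (d : ℕ) : ℝ :=
  ∏ k ∈ Finset.Icc 1 d, (((k : ℝ) - 1 / 2) ^ 2 + 3 / 4 * (2 * (d : ℝ) - 1) ^ 2)

/-- `Q(d) = ∏_{k=1}^d (k² + 3d²)`, a real number. -/
noncomputable def sinhProd (d : ℕ) : ℝ :=
  ∏ k ∈ Finset.Icc 1 d, ((k : ℝ) ^ 2 + 3 * (d : ℝ) ^ 2)

/-- The `d`-th term `3πP(d) / ((2d-1)! (2d-1)³ cosh(√3π(2d-1)/2))` of the first series,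
meant for `d ≥ 1` (so that the truncated subtraction in the factorial is the true one). -/
noncomputable def coshTerm (d : ℕ) : ℝ :=
  3 * Real.pi * coshProd d /
    (((2 * d - 1).factorial : ℝ) * (2 * (d : ℝ) - 1) ^ 3 *
      Real.cosh (Real.sqrt 3 * Real.pi * (2 * (d : ℝ) - 1) / 2))

/-- The `d`-th term `3√3πQ(d) / (8 sinh(√3πd) (2d)! d²)` of the second series,
meant for `d ≥ 1`. -/
noncomputable def sinhTerm (d : ℕ) : ℝ :=
  3 * Real.sqrt 3 * Real.pi * sinhProd d /
    (8 * Real.sinh (Real.sqrt 3 * Real.pi * (d : ℝ)) * ((2 * d).factorial : ℝ) * (d : ℝ) ^ 2)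

open Finset Filter Topology Complex

/-! Lagrange interpolation at the nodes `m ^ 3`, `m ≤ N`, turns the partial sum of `ζ(3)` into an
alternating sum of `cubeCoeff N n / n ^ 3` (`sum_inv_cube_eq_tsum_cubeCoeff`). For fixed `n`, the
factorisation `m² + mn + n² = (m + z)(m + w)` with `z, w = n/2 ± i√3n/2` makes the coefficient
converge to a product of two Gamma values (`tendsto_cubeCoeff`). The reflection formula evaluates
it, through sinh for even `n` and cosh for odd `n`. The uniform bound `cubeCoeff_le` permits
dominated convergence; splitting by parity gives the two series. -/

theorem sum_inv_eq_sum_prod_div_sub {ι F : Type*} [DecidableEq ι] [Field F] (v : ι → F)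
    (hv : Function.Injective v) (s : Finset ι) (h0 : ∀ i ∈ s, v i ≠ 0) :
    ∑ i ∈ s, (v i)⁻¹ = ∑ i ∈ s, (∏ j ∈ s.erase i, v j / (v j - v i)) / v i := by
  induction s using Finset.induction_on with
  | empty => simp
  | insert a s ha ih =>
    have hva : v a ≠ 0 := h0 a (mem_insert_self a s)
    -- The Lagrange basis polynomials sum to 1; evaluating at 0 makes the new coefficients sum to 1.
    have hbasis := congrArg (Polynomial.eval 0)
      (Lagrange.sum_basis (v := v) (s := insert a s) hv.injOn ⟨a, mem_insert_self a s⟩)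
    have hev : ∀ i, (Lagrange.basis (insert a s) v i).eval 0
        = ∏ j ∈ (insert a s).erase i, v j / (v j - v i) := by
      intro i
      rw [Lagrange.basis, Polynomial.eval_prod]
      refine prod_congr rfl fun j hj => ?_
      rw [Lagrange.basisDivisor]
      simp only [Polynomial.eval_mul, Polynomial.eval_C, Polynomial.eval_sub, Polynomial.eval_X,
        zero_sub]
      rw [← neg_sub (v j) (v i), inv_neg, neg_mul_neg, div_eq_inv_mul]
    rw [Polynomial.eval_finsetSum, Polynomial.eval_one] at hbasis
    simp only [hev] at hbasis
    rw [sum_insert ha, erase_insert ha] at hbasis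
    rw [sum_insert ha, sum_insert ha, erase_insert ha,
      ih fun i hi => h0 i (mem_insert_of_mem hi)]
    -- The new node multiplies a coefficient by `v a / (v a - v i)`; the excess is the new
    -- coefficient over `v a`.
    have hstep : ∀ i ∈ s, (∏ j ∈ (insert a s).erase i, v j / (v j - v i)) / v i
        = (∏ j ∈ s.erase i, v j / (v j - v i)) / v i
          + (∏ j ∈ (insert a s).erase i, v j / (v j - v i)) / v a := by
      intro i hi
      have hai : a ≠ i := fun h => ha (h ▸ hi)
      have hvi : v i ≠ 0 := h0 i (mem_insert_of_mem hi)
      have hd : v a - v i ≠ 0 := sub_ne_zero.2 fun h => hai (hv h)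
      rw [erase_insert_of_ne hai, prod_insert fun h => ha (mem_of_mem_erase h)]
      field_simp
      ring
    rw [sum_congr rfl hstep, sum_add_distrib, ← sum_div]
    have : (∏ x ∈ s, v x / (v x - v a)) / v a
        + (∑ i ∈ s, ∏ j ∈ (insert a s).erase i, v j / (v j - v i)) / v a = (v a)⁻¹ := by
      rw [← add_div, hbasis, one_div]
    linear_combination -this

/-! ### Interpolation coefficients at the cubes -/

theorem prod_div_sub_eq_choose {N n : ℕ} (hn : 1 ≤ n) (hN : n ≤ N) :
    ∏ m ∈ (Icc 1 N).erase n, ((m : ℝ) / (m - n)) = (-1) ^ (n + 1) * N.choose n := by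
  induction N, hN using Nat.le_induction with
  | base =>
    obtain ⟨k, rfl⟩ : ∃ k, n = k + 1 := ⟨n - 1, by omega⟩
    have he : (Icc 1 (k + 1)).erase (k + 1) = (range k).image (· + 1) := by
      ext m
      simp only [mem_erase, mem_Icc, mem_image, mem_range]
      exact ⟨fun h => ⟨m - 1, by omega, by omega⟩, by rintro ⟨a, h, rfl⟩; omega⟩
    rw [he, prod_image (by simp), prod_div_distrib]
    have h1 : ∏ i ∈ range k, (((i + 1 : ℕ) : ℝ) - ((k + 1 : ℕ) : ℝ))
        = (-1) ^ k * ∏ i ∈ range k, ((i + 1 : ℕ) : ℝ) := by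
      rw [← prod_range_reflect (fun i => ((i + 1 : ℕ) : ℝ)), ← card_range k, ← prod_const,
        card_range, ← prod_mul_distrib]
      refine prod_congr rfl fun i hi => ?_
      have : k - 1 - i + 1 = k - i := by have := mem_range.1 hi; omega
      rw [this, Nat.cast_sub (mem_range.1 hi).le]
      push_cast
      ring
    have h2 : ∏ i ∈ range k, ((i + 1 : ℕ) : ℝ) ≠ 0 := prod_ne_zero_iff.2 fun i _ => by positivity
    rw [h1, Nat.choose_self, div_mul_cancel_right₀ h2, ← inv_pow]
    norm_num [pow_succ]
  | succ N hN ih =>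
    have he : (Icc 1 (N + 1)).erase n = insert (N + 1) ((Icc 1 N).erase n) := by
      ext m
      simp only [mem_erase, mem_Icc, mem_insert]
      omega
    have hd : ((N : ℝ) + 1 - n) ≠ 0 := by
      have : (n : ℝ) ≤ N := by exact_mod_cast hN
      linarith
    have hc := congrArg (Nat.cast (R := ℝ)) (Nat.choose_mul_succ_eq N n)
    push_cast [Nat.cast_sub (show n ≤ N + 1 by omega)] at hc
    rw [he, prod_insert (by simp), ih]
    push_cast
    field_simp
    linear_combination hc

/-- The absolute value of `∏ m³ / (m³ - n³)` over the `m ≤ N` other than `n`. -/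
noncomputable def cubeCoeff (N n : ℕ) : ℝ :=
  3 * N.choose n * ∏ m ∈ Icc 1 N, ((m : ℝ) ^ 2 / (m ^ 2 + m * n + n ^ 2))

theorem prod_cube_div_sub_cube {N n : ℕ} (hn : 1 ≤ n) (hN : n ≤ N) :
    ∏ m ∈ (Icc 1 N).erase n, ((m : ℝ) ^ 3 / (m ^ 3 - n ^ 3))
      = (-1) ^ (n + 1) * cubeCoeff N n := by
  have hn0 : (n : ℝ) ≠ 0 := by positivity
  have hfac : ∀ m ∈ (Icc 1 N).erase n, ((m : ℝ) ^ 3 / (m ^ 3 - n ^ 3))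
      = (m / (m - n)) * ((m : ℝ) ^ 2 / (m ^ 2 + m * n + n ^ 2)) := by
    intro m hm
    rw [div_mul_div_comm]
    congr 1 <;> ring
  rw [prod_congr rfl hfac, prod_mul_distrib, prod_div_sub_eq_choose hn hN, cubeCoeff,
    ← mul_prod_erase (Icc 1 N) _ (mem_Icc.2 ⟨hn, hN⟩)]
  -- Restoring the factor `m = n` costs 1/3, whence the 3 in `cubeCoeff`.
  have : (n : ℝ) ^ 2 / (n ^ 2 + n * n + n ^ 2) = 1 / 3 := by
    field_simp
    ring
  rw [this]
  ring

theorem cubeCoeff_nonneg (N n : ℕ) : 0 ≤ cubeCoeff N n := by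
  unfold cubeCoeff
  exact mul_nonneg (by positivity) (prod_nonneg fun m _ => by positivity)

theorem prod_div_add_mul_choose (N n : ℕ) :
    (∏ m ∈ Icc 1 N, ((m : ℝ) / (m + n))) * (N + n).choose n = 1 := by
  induction N with
  | zero => simp
  | succ N ih =>
    have hc := congrArg (Nat.cast (R := ℝ)) (Nat.choose_mul_succ_eq (N + n) n)
    rw [show N + n + 1 - n = N + 1 by omega, show N + n + 1 = N + 1 + n by ring] at hc
    push_cast at hc
    rw [prod_Icc_succ_top (by omega)]
    push_cast
    rw [mul_assoc, div_mul_eq_mul_div, mul_comm ((N : ℝ) + 1), ← hc,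
      mul_div_cancel_right₀ _ (by positivity), ih]

/-- Since `m² + mn + n² ≥ m(m + n)`, the product is at most the inverse of `(N + n).choose n`, which
dominates `N.choose n`. -/
theorem cubeCoeff_le (N n : ℕ) : cubeCoeff N n ≤ 3 := by
  have h1 : ∏ m ∈ Icc 1 N, ((m : ℝ) ^ 2 / (m ^ 2 + m * n + n ^ 2))
      ≤ ∏ m ∈ Icc 1 N, ((m : ℝ) / (m + n)) := by
    refine prod_le_prod (fun m _ => by positivity) fun m hm => ?_
    have hm : (0 : ℝ) < m := by exact_mod_cast (mem_Icc.1 hm).1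
    rw [div_le_div_iff₀ (by positivity) (by positivity)]
    nlinarith [mul_nonneg hm.le (sq_nonneg (n : ℝ))]
  have h2 : (N.choose n : ℝ) ≤ (N + n).choose n := by
    exact_mod_cast Nat.choose_le_choose n (Nat.le_add_right N n)
  calc cubeCoeff N n ≤ 3 * (N + n).choose n * ∏ m ∈ Icc 1 N, ((m : ℝ) / (m + n)) := by
        unfold cubeCoeff
        refine mul_le_mul (by linarith) h1 (prod_nonneg fun m _ => by positivity) (by positivity)
    _ = 3 := by linear_combination 3 * prod_div_add_mul_choose N n

theorem sum_inv_cube_eq_tsum_cubeCoeff (N : ℕ) :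
    ∑ m ∈ Icc 1 N, ((m : ℝ) ^ 3)⁻¹
      = ∑' n : ℕ, (-1) ^ (n + 1) * cubeCoeff N n / (n : ℝ) ^ 3 := by
  rw [tsum_eq_sum (s := Icc 1 N)]
  · rw [sum_inv_eq_sum_prod_div_sub (fun m : ℕ => (m : ℝ) ^ 3)]
    · refine sum_congr rfl fun n hn => ?_
      rw [prod_cube_div_sub_cube (mem_Icc.1 hn).1 (mem_Icc.1 hn).2]
    · intro a b h
      have h : (a : ℝ) ^ 3 = (b : ℝ) ^ 3 := h
      exact Nat.pow_left_injective (n := 3) (by norm_num) (by exact_mod_cast h)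
    · intro i hi
      have : 0 < i := (mem_Icc.1 hi).1
      positivity
  · intro n hn
    -- The term `n = 0` vanishes because division by zero gives 0, those with `n > N` because the
    -- binomial does.
    rcases Nat.eq_zero_or_pos n with rfl | h
    · simp
    · have : N < n := by
        by_contra h'
        exact hn (mem_Icc.2 ⟨h, not_lt.1 h'⟩)
      simp [cubeCoeff, Nat.choose_eq_zero_of_lt this]

/-! ### Limits of the coefficients via the Gamma function -/

theorem tendsto_choose_div_pow (n : ℕ) :
    Tendsto (fun N : ℕ => (N.choose n : ℝ) / (N : ℝ) ^ n) atTop (𝓝 (1 / n.factorial)) := by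
  have h := (isEquivalent_choose n).div
    (Asymptotics.IsEquivalent.refl (u := fun N : ℕ => (N : ℝ) ^ n))
  have h2 := h.tendsto_nhds_iff (c := (1 / n.factorial : ℝ))
  refine h2.2 (tendsto_const_nhds.congr' ?_)
  filter_upwards [eventually_gt_atTop 0] with N hN
  simp only [Pi.div_apply]
  field_simp

theorem tendsto_cubeCoeff {n : ℕ} (hn : 1 ≤ n) {z w : ℂ} (hadd : z + w = n)
    (hmul : z * w = (n : ℂ) ^ 2) :
    Tendsto (fun N : ℕ => (cubeCoeff N n : ℂ)) atTop
      (𝓝 (3 / n.factorial * (Gamma (z + 1) * Gamma (w + 1)))) := by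
  have hn0 : (n : ℂ) ≠ 0 := by exact_mod_cast (by omega : n ≠ 0)
  have hz : z ≠ 0 := left_ne_zero_of_mul (hmul ▸ pow_ne_zero 2 hn0)
  have hw : w ≠ 0 := right_ne_zero_of_mul (hmul ▸ pow_ne_zero 2 hn0)
  have hc : Tendsto (fun N : ℕ => (((N.choose n : ℝ) / (N : ℝ) ^ n : ℝ) : ℂ)) atTop
      (𝓝 ((1 / n.factorial : ℝ) : ℂ)) :=
    (continuous_ofReal.tendsto _).comp (tendsto_choose_div_pow n)
  -- The factor `n²` compensates for the index `j = 0` in Euler's products, which contributes `zw`.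
  have hlim := (hc.mul ((GammaSeq_tendsto_Gamma z).mul (GammaSeq_tendsto_Gamma w))).const_mul
    (3 * (n : ℂ) ^ 2)
  rw [Gamma_add_one z hz, Gamma_add_one w hw]
  have hval : 3 / (n.factorial : ℂ) * (z * Gamma z * (w * Gamma w))
      = 3 * (n : ℂ) ^ 2 * (((1 / n.factorial : ℝ) : ℂ) * (Gamma z * Gamma w)) := by
    rw [← hmul]
    push_cast
    ring
  rw [hval]
  refine hlim.congr' ?_
  filter_upwards [eventually_gt_atTop 0] with N hN
  have hN0 : (N : ℂ) ≠ 0 := by exact_mod_cast hN.ne'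
  have hprod : (∏ j ∈ range (N + 1), (z + j)) * ∏ j ∈ range (N + 1), (w + j)
      = (n : ℂ) ^ 2 * ∏ m ∈ Icc 1 N, ((m : ℂ) ^ 2 + m * n + n ^ 2) := by
    have hIcc : Icc 1 N = (range N).image (· + 1) := by
      ext m
      simp only [mem_Icc, mem_image, mem_range]
      exact ⟨fun h => ⟨m - 1, by omega, by omega⟩, by rintro ⟨a, h, rfl⟩; omega⟩
    rw [← prod_mul_distrib, prod_range_succ', hIcc, prod_image (by simp), mul_comm]
    congr 1
    · simp [hmul]
    · refine prod_congr rfl fun m _ => ?_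
      push_cast
      linear_combination hmul + ((m : ℂ) + 1) * hadd
  have hfact : (N.factorial : ℂ) ^ 2 = ∏ m ∈ Icc 1 N, (m : ℂ) ^ 2 := by
    rw [← prod_Ico_id_eq_factorial, Ico_add_one_right_eq_Icc, prod_pow]
    push_cast
    rfl
  have hpow : (N : ℂ) ^ z * (N : ℂ) ^ w = (N : ℂ) ^ n := by
    rw [← cpow_add _ _ hN0, hadd, cpow_natCast]
  rw [GammaSeq, GammaSeq, div_mul_div_comm, hprod, cubeCoeff]
  push_cast
  rw [prod_div_distrib, ← hfact,
    show (N : ℂ) ^ z * N.factorial * ((N : ℂ) ^ w * N.factorial)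
      = ((N : ℂ) ^ z * (N : ℂ) ^ w) * (N.factorial : ℂ) ^ 2 by ring, hpow]
  have hp : (N : ℂ) ^ n ≠ 0 := pow_ne_zero _ hN0
  by_cases hQ : ∏ m ∈ Icc 1 N, ((m : ℂ) ^ 2 + m * n + n ^ 2) = 0
  · simp [hQ]
  · field_simp

theorem Gamma_add_nat_mul_Gamma_add_nat (z w : ℂ) (hz : 0 < z.re) (hw : 0 < w.re) (d : ℕ) :
    Gamma (z + d) * Gamma (w + d)
      = (∏ k ∈ Icc 1 d, ((z + k - 1) * (w + k - 1))) * (Gamma z * Gamma w) := by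
  induction d with
  | zero => simp
  | succ d ih =>
    have h1 : z + d ≠ 0 := fun h => by
      have := congrArg re h
      simp at this
      linarith [Nat.cast_nonneg (α := ℝ) d]
    have h2 : w + d ≠ 0 := fun h => by
      have := congrArg re h
      simp at this
      linarith [Nat.cast_nonneg (α := ℝ) d]
    rw [prod_Icc_succ_top (by omega)]
    push_cast
    rw [← add_assoc, ← add_assoc, Gamma_add_one _ h1, Gamma_add_one _ h2]
    linear_combination (z + d) * (w + d) * ih

theorem Gamma_one_add_mul_I_mul_conj {y : ℝ} (hy : y ≠ 0) :
    Gamma (1 + y * I) * Gamma (1 - y * I) = ((Real.pi * y / Real.sinh (Real.pi * y) : ℝ) : ℂ) := by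
  have hyI : (y : ℂ) * I ≠ 0 := mul_ne_zero (by exact_mod_cast hy) I_ne_zero
  have hs : sinh ((Real.pi : ℂ) * y) ≠ 0 := by
    rw [← ofReal_mul, ← ofReal_sinh]
    exact_mod_cast fun h => hy (by simpa [Real.pi_ne_zero] using h)
  rw [add_comm 1, Gamma_add_one _ hyI, mul_assoc, Gamma_mul_Gamma_one_sub, ← mul_assoc, sin_mul_I]
  push_cast
  field_simp

theorem Gamma_half_add_mul_I_mul_conj (y : ℝ) :
    Gamma (1 / 2 + y * I) * Gamma (1 / 2 - y * I)
      = ((Real.pi / Real.cosh (Real.pi * y) : ℝ) : ℂ) := by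
  have h := Gamma_mul_Gamma_one_sub (1 / 2 + y * I)
  rw [show (1 : ℂ) - (1 / 2 + y * I) = 1 / 2 - y * I by ring] at h
  rw [h, mul_add, show (Real.pi : ℂ) * (1 / 2) = Real.pi / 2 by ring, add_comm, sin_add_pi_div_two,
    ← mul_assoc, cos_mul_I]
  push_cast
  rfl

theorem sqrt_three_sq_complex : ((Real.sqrt 3 : ℝ) : ℂ) ^ 2 = 3 := by
  rw [← ofReal_pow, Real.sq_sqrt (by norm_num)]
  norm_num

theorem tendsto_cubeCoeff_even {d : ℕ} (hd : 1 ≤ d) :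
    Tendsto (fun N => cubeCoeff N (2 * d)) atTop (𝓝 ((2 * d : ℝ) ^ 3 * sinhTerm d)) := by
  have h := tendsto_cubeCoeff (n := 2 * d) (by omega) (z := d + (Real.sqrt 3 * d : ℝ) * I)
    (w := d - (Real.sqrt 3 * d : ℝ) * I) (by push_cast; ring) (by
      push_cast
      linear_combination (d : ℂ) ^ 2 * sqrt_three_sq_complex
        - (d : ℂ) ^ 2 * (Real.sqrt 3 : ℂ) ^ 2 * I_sq)
  have hy : Real.sqrt 3 * d ≠ 0 := by positivity
  have hG := Gamma_add_nat_mul_Gamma_add_nat (1 + (Real.sqrt 3 * d : ℝ) * I)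
    (1 - (Real.sqrt 3 * d : ℝ) * I) (by simp) (by simp) d
  rw [Gamma_one_add_mul_I_mul_conj hy] at hG
  have hQ : ∏ k ∈ Icc 1 d, ((1 + (Real.sqrt 3 * d : ℝ) * I + k - 1)
      * (1 - (Real.sqrt 3 * d : ℝ) * I + k - 1)) = (sinhProd d : ℂ) := by
    rw [sinhProd]
    push_cast
    refine prod_congr rfl fun k _ => ?_
    linear_combination (d : ℂ) ^ 2 * sqrt_three_sq_complex
        - (d : ℂ) ^ 2 * (Real.sqrt 3 : ℂ) ^ 2 * I_sq
  rw [hQ] at hG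
  rw [show (d : ℂ) + (Real.sqrt 3 * d : ℝ) * I + 1 = 1 + (Real.sqrt 3 * d : ℝ) * I + d by ring,
    show (d : ℂ) - (Real.sqrt 3 * d : ℝ) * I + 1 = 1 - (Real.sqrt 3 * d : ℝ) * I + d by ring,
    hG] at h
  have h' := (continuous_re.tendsto _).comp h
  convert h' using 2
  · rfl
  rw [show (3 : ℂ) / ((2 * d).factorial : ℂ) * ((sinhProd d : ℂ)
      * ((Real.pi * (Real.sqrt 3 * d) / Real.sinh (Real.pi * (Real.sqrt 3 * d)) : ℝ) : ℂ))
    = ((3 / ((2 * d).factorial : ℝ) * (sinhProd d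
      * (Real.pi * (Real.sqrt 3 * d) / Real.sinh (Real.pi * (Real.sqrt 3 * d)))) : ℝ) : ℂ) by
    push_cast; rfl, ofReal_re, sinhTerm,
    show Real.pi * (Real.sqrt 3 * d) = Real.sqrt 3 * Real.pi * d by ring]
  have hs : Real.sinh (Real.sqrt 3 * Real.pi * d) ≠ 0 := by
    rw [Ne, Real.sinh_eq_zero]
    positivity
  have hd0 : (d : ℝ) ≠ 0 := by positivity
  field_simp
  ring

/-- Here the roots have half-integer real part, so `d` unit shifts lead down to `1/2 ± iy`, where
reflection gives cosh; in the even case they lead to `1 ± iy` and sinh. -/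
theorem tendsto_cubeCoeff_odd {d : ℕ} (hd : 1 ≤ d) :
    Tendsto (fun N => cubeCoeff N (2 * d - 1)) atTop
      (𝓝 ((2 * d - 1 : ℝ) ^ 3 * coshTerm d)) := by
  have hcast : ((2 * d - 1 : ℕ) : ℂ) = 2 * d - 1 := by
    push_cast [Nat.cast_sub (show 1 ≤ 2 * d by omega)]
    ring
  set y : ℝ := Real.sqrt 3 * (2 * d - 1) / 2 with hy
  have hyc : (y : ℂ) ^ 2 = 3 / 4 * (2 * d - 1) ^ 2 := by
    rw [hy]
    push_cast
    linear_combination (2 * (d : ℂ) - 1) ^ 2 / 4 * sqrt_three_sq_complex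
  have h := tendsto_cubeCoeff (n := 2 * d - 1) (by omega) (z := d - 1 / 2 + y * I)
    (w := d - 1 / 2 - y * I) (by rw [hcast]; ring) (by
      rw [hcast]
      linear_combination hyc - (y : ℂ) ^ 2 * I_sq)
  have hG := Gamma_add_nat_mul_Gamma_add_nat (1 / 2 + y * I) (1 / 2 - y * I)
    (by simp) (by simp) d
  rw [Gamma_half_add_mul_I_mul_conj] at hG
  have hP : ∏ k ∈ Icc 1 d, ((1 / 2 + y * I + k - 1) * (1 / 2 - y * I + k - 1))
      = (coshProd d : ℂ) := by
    rw [coshProd]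
    push_cast
    refine prod_congr rfl fun k _ => ?_
    linear_combination hyc - (y : ℂ) ^ 2 * I_sq
  rw [hP] at hG
  rw [show (d : ℂ) - 1 / 2 + y * I + 1 = 1 / 2 + y * I + d by ring,
    show (d : ℂ) - 1 / 2 - y * I + 1 = 1 / 2 - y * I + d by ring, hG] at h
  have h' := (continuous_re.tendsto _).comp h
  convert h' using 2
  · rfl
  rw [show (3 : ℂ) / ((2 * d - 1).factorial : ℂ) * ((coshProd d : ℂ)
      * ((Real.pi / Real.cosh (Real.pi * y) : ℝ) : ℂ))
    = ((3 / ((2 * d - 1).factorial : ℝ) * (coshProd d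
      * (Real.pi / Real.cosh (Real.pi * y))) : ℝ) : ℂ) by
    push_cast; rfl, ofReal_re, coshTerm,
    show Real.pi * y = Real.sqrt 3 * Real.pi * (2 * d - 1) / 2 by rw [hy]; ring]
  have hs := (Real.cosh_pos (Real.sqrt 3 * Real.pi * (2 * d - 1) / 2)).ne'
  have hd0 : (2 * d - 1 : ℝ) ≠ 0 := by
    have : (1 : ℝ) ≤ d := by exact_mod_cast hd
    linarith
  field_simp

/-! ### Dominated convergence and splitting by parity -/

/-- The limit of `cubeCoeff N n / n³` as `N → ∞`. -/
noncomputable def cubeLimit (n : ℕ) : ℝ :=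
  if n = 0 then 0 else if Even n then sinhTerm (n / 2) else coshTerm ((n + 1) / 2)

theorem cubeLimit_two_mul {d : ℕ} (hd : 1 ≤ d) : cubeLimit (2 * d) = sinhTerm d := by
  simp [cubeLimit, show d ≠ 0 by omega]

theorem cubeLimit_two_mul_sub_one {d : ℕ} (hd : 1 ≤ d) : cubeLimit (2 * d - 1) = coshTerm d := by
  have h : ¬ Even (2 * d - 1) := by rw [Nat.even_iff]; omega
  rw [cubeLimit, if_neg (by omega), if_neg h, show (2 * d - 1 + 1) / 2 = d by omega]

theorem tendsto_cubeCoeff_div (n : ℕ) :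
    Tendsto (fun N => cubeCoeff N n / (n : ℝ) ^ 3) atTop (𝓝 (cubeLimit n)) := by
  rcases Nat.eq_zero_or_pos n with rfl | hn
  · simp [cubeLimit]
  have hn0 : (n : ℝ) ^ 3 ≠ 0 := by positivity
  rcases Nat.even_or_odd' n with ⟨d, rfl | rfl⟩
  · have h := (tendsto_cubeCoeff_even (d := d) (by omega)).div_const (((2 * d : ℕ) : ℝ) ^ 3)
    rw [cubeLimit_two_mul (by omega)]
    convert h using 2
    push_cast at hn0 ⊢
    rw [mul_div_cancel_left₀ _ hn0]
  · have h := (tendsto_cubeCoeff_odd (d := d + 1) (by omega)).div_const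
      (((2 * d + 1 : ℕ) : ℝ) ^ 3)
    have hL := cubeLimit_two_mul_sub_one (d := d + 1) (by omega)
    rw [show 2 * (d + 1) - 1 = 2 * d + 1 by omega] at h hL
    rw [hL]
    convert h using 2
    push_cast at hn0 ⊢
    rw [show 2 * ((d : ℝ) + 1) - 1 = 2 * d + 1 by ring, mul_div_cancel_left₀ _ hn0]

theorem cubeLimit_nonneg (n : ℕ) : 0 ≤ cubeLimit n :=
  ge_of_tendsto' (tendsto_cubeCoeff_div n) fun N =>
    div_nonneg (cubeCoeff_nonneg N n) (by positivity)

/-- Inherited from the finite coefficients, so summability needs no estimate of the explicit terms.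
-/
theorem cubeLimit_le (n : ℕ) : cubeLimit n ≤ 3 * ((n : ℝ) ^ 3)⁻¹ :=
  le_of_tendsto' (tendsto_cubeCoeff_div n) fun N => by
    rw [div_eq_mul_inv]
    exact mul_le_mul_of_nonneg_right (cubeCoeff_le N n) (by positivity)

theorem summable_three_mul_inv_cube : Summable fun n : ℕ => 3 * ((n : ℝ) ^ 3)⁻¹ :=
  (Real.summable_nat_pow_inv.2 (by norm_num)).mul_left 3

theorem summable_cubeLimit : Summable cubeLimit :=
  summable_three_mul_inv_cube.of_nonneg_of_le cubeLimit_nonneg cubeLimit_le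

theorem tsum_inv_cube_eq_tsum_cubeLimit :
    ∑' n : ℕ, ((n : ℝ) ^ 3)⁻¹ = ∑' n : ℕ, (-1) ^ (n + 1) * cubeLimit n := by
  have h1 : Tendsto (fun N => ∑' n : ℕ, (-1) ^ (n + 1) * cubeCoeff N n / (n : ℝ) ^ 3) atTop
      (𝓝 (∑' n : ℕ, (-1) ^ (n + 1) * cubeLimit n)) := by
    refine tendsto_tsum_of_dominated_convergence summable_three_mul_inv_cube (fun n => ?_)
      (Eventually.of_forall fun N n => ?_)
    · simp only [mul_div_assoc]
      exact (tendsto_cubeCoeff_div n).const_mul _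
    · rw [norm_div, norm_mul, norm_pow, norm_neg, norm_one, one_pow, one_mul,
        Real.norm_of_nonneg (cubeCoeff_nonneg N n), Real.norm_of_nonneg (by positivity),
        div_eq_mul_inv]
      exact mul_le_mul_of_nonneg_right (cubeCoeff_le N n) (by positivity)
  have hs : Summable fun n : ℕ => ((n : ℝ) ^ 3)⁻¹ := Real.summable_nat_pow_inv.2 (by norm_num)
  have h2 := (hs.hasSum.tendsto_sum_nat).comp (tendsto_add_atTop_nat 1)
  refine tendsto_nhds_unique h2 (h1.congr fun N => ?_)
  rw [← sum_inv_cube_eq_tsum_cubeCoeff, Function.comp_apply]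
  refine sum_subset (fun m hm => ?_) fun m hm hm' => ?_
  · simp only [mem_Icc, mem_range] at *
    omega
  · have : m = 0 := by
      simp only [mem_Icc, mem_range] at *
      omega
    simp [this]

theorem proposition2 :
    Summable (fun d : ℕ+ => coshTerm d) ∧
    Summable (fun d : ℕ+ => sinhTerm d) ∧
    riemannZeta 3 =
      (((∑' d : ℕ+, coshTerm d) - (∑' d : ℕ+, sinhTerm d) : ℝ) : ℂ) := by
  have hsinh : (fun d : ℕ+ => sinhTerm d) = fun d : ℕ+ => cubeLimit (2 * d) :=
    funext fun d => (cubeLimit_two_mul d.pos).symm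
  have hcosh : (fun d : ℕ+ => coshTerm d) = fun d : ℕ+ => cubeLimit (2 * d - 1) :=
    funext fun d => (cubeLimit_two_mul_sub_one d.pos).symm
  have hev : Summable fun k : ℕ => cubeLimit (2 * k) :=
    summable_cubeLimit.comp_injective fun a b h => by simpa using h
  have hod : Summable fun k : ℕ => cubeLimit (2 * k + 1) :=
    summable_cubeLimit.comp_injective fun a b h => by simpa using h
  refine ⟨?_, ?_, ?_⟩
  · rw [hcosh]
    exact summable_cubeLimit.comp_injective fun a b h => by
      have := a.pos
      have := b.pos
      have h : 2 * (a : ℕ) - 1 = 2 * (b : ℕ) - 1 := h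
      exact PNat.eq (by omega)
  · rw [hsinh]
    exact summable_cubeLimit.comp_injective fun a b h => PNat.eq (by simpa using h)
  · have hc : ∑' d : ℕ+, coshTerm d = ∑' k : ℕ, cubeLimit (2 * k + 1) := by
      rw [hcosh]
      exact tsum_pnat_eq_tsum_succ (f := fun k => cubeLimit (2 * k - 1))
    have hs : ∑' d : ℕ+, sinhTerm d = ∑' k : ℕ, cubeLimit (2 * k) := by
      rw [hsinh]
      have := tsum_zero_pnat_eq_tsum_nat hev
      rwa [mul_zero, show cubeLimit 0 = 0 by simp [cubeLimit], zero_add] at this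
    have hz : riemannZeta 3 = ((∑' n : ℕ, ((n : ℝ) ^ 3)⁻¹ : ℝ) : ℂ) := by
      have := zeta_nat_eq_tsum_of_gt_one (k := 3) (by norm_num)
      rw [ofReal_tsum]
      simpa using this
    have heven : ∀ k : ℕ, (-1 : ℝ) ^ (2 * k + 1) * cubeLimit (2 * k) = -cubeLimit (2 * k) :=
      fun k => by simp [pow_succ, pow_mul]
    have hodd : ∀ k : ℕ,
        (-1 : ℝ) ^ (2 * k + 1 + 1) * cubeLimit (2 * k + 1) = cubeLimit (2 * k + 1) :=
      fun k => by simp [pow_succ, pow_mul]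
    rw [hz, tsum_inv_cube_eq_tsum_cubeLimit, hc, hs, ofReal_inj, ← tsum_even_add_odd]
    · rw [tsum_congr heven, tsum_congr hodd, tsum_neg]
      ring
    · exact hev.neg.congr fun k => (heven k).symm
    · exact hod.congr fun k => (hodd k).symm
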